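/- Let $X$ and $Y$ be Banach spaces over the same field $\mathbb K\in\{\mathbb R,\mathbb C\}$, let $\Omega$ be a compact Hausdorff space, and let $\Sigma$ be the $\sigma$-algebra of Borel subsets of $\Omega$. Write $\mathcal C(\Omega)$ and $\mathcal C(\Omega,X)$ for the Banach spaces of continuous functions from $\Omega$ to $\mathbb K$ and to $X$ (with the supremum norm), $\mathcal L(\cdot,\cdot)$ for the bounded linear operators, $B_X$ for the closed unit ball of $X$, and regard $Y$ as a subspace of $Y^{**}$ in the canonical way. Let $S\in\mathcal L(\mathcal C(\Omega),\mathcal L(X,Y))$ and let $m:\Sigma\to\mathcal L(X,Y^{**})$ be its representing measure, that is, for every $x\in X$ the set function $m_x:\Sigma\to Y^{**}$, $m_x(E)=m(E)x$, is the representing measure of the operator $S_x\in\mathcal L(\mathcal C(\Omega),Y)$, $S_x\varphi=(S\varphi)x$: it is of bounded semivariation, $E\mapsto\langle y^*,m_x(E)\rangle$ is a regular countably additive Borel measure for every $y^*\in Y^*$, and $S_x\varphi=\int_\Omega\varphi\,dm_x$ for all $\varphi\in\mathcal C(\Omega)$, where the integral is the elementary Bartle integral (the limit of the integrals of simple functions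 converging uniformly to $\varphi$). For $U\in\mathcal L(\mathcal C(\Omega,X),Y)$ let $U^{\#}\in\mathcal L(\mathcal C(\Omega),\mathcal L(X,Y))$ be the associated operator, $(U^{\#}\varphi)x=U(\varphi x)$ for $\varphi\in\mathcal C(\Omega)$ and $x\in X$. For a sequence $(z_i)$ in a Banach space $Z$ put $\|(z_i)\|_1^w=\sup\{\sum_{i=1}^\infty|z^*(z_i)| : z^*\in Z^*,\ \|z^*\|\le1\}\in[0,\infty]$. Then the following statements are equivalent. (a) There exists an operator $U\in\mathcal L(\mathcal C(\Omega,X),Y)$ such that $U^{\#}=S$. (b) There exists a constant $c>0$ such that, for every sequence $(E_i)$ of pairwise disjoint sets in $\Sigma$ and every sequence $(x_i)$ in $B_X$, the inequality $\|(m(E_i)x_i)\|_1^w\le c$ holds. -/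

import Mathlib

open MeasureTheory Filter Topology
open scoped ENNReal

noncomputable section

namespace RepMeasure

section Associated

variable {Ω 𝕜 X Y : Type*} [RCLike 𝕜] [TopologicalSpace Ω] [CompactSpace Ω]
  [NormedAddCommGroup X] [NormedSpace 𝕜 X] [NormedAddCommGroup Y] [NormedSpace 𝕜 Y]

/-- For `φ ∈ C(Ω)` and `x ∈ X`, the function `φ x ∈ C(Ω, X)`, `ω ↦ φ(ω) x`. -/
def elem (φ : C(Ω, 𝕜)) (x : X) : C(Ω, X) where
  toFun ω := φ ω • x
  continuous_toFun := by fun_prop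

theorem norm_elem_le (φ : C(Ω, 𝕜)) (x : X) : ‖elem φ x‖ ≤ ‖φ‖ * ‖x‖ := by
  rw [ContinuousMap.norm_le _ (by positivity)]
  intro ω
  change ‖φ ω • x‖ ≤ _
  rw [norm_smul]
  gcongr
  exact φ.norm_coe_le_norm ω

/-- The operator `U^# ∈ L(C(Ω), L(X, Y))` associated to `U ∈ L(C(Ω, X), Y)`:
`(U^# φ) x = U (φ x)`. -/
def associated (U : C(Ω, X) →L[𝕜] Y) : C(Ω, 𝕜) →L[𝕜] X →L[𝕜] Y :=
  LinearMap.mkContinuous₂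
    (LinearMap.mk₂ 𝕜 (fun φ x => U (elem φ x))
      (fun φ ψ x => by
        rw [← map_add]; congr 1; ext ω; exact add_smul (φ ω) (ψ ω) x)
      (fun a φ x => by
        rw [← map_smul]; congr 1; ext ω; exact smul_assoc a (φ ω) x)
      (fun φ x y => by
        rw [← map_add]; congr 1; ext ω; exact smul_add (φ ω) x y)
      (fun a φ x => by
        rw [← map_smul]; congr 1; ext ω; exact smul_comm (φ ω) a x))
    ‖U‖
    (fun φ x => by
      rw [mul_assoc]
      exact (U.le_opNorm _).trans (by gcongr; exact norm_elem_le φ x))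

@[simp] theorem associated_apply (U : C(Ω, X) →L[𝕜] Y) (φ : C(Ω, 𝕜)) (x : X) :
    associated U φ x = U (elem φ x) := rfl

end Associated

section Measures

variable {Ω 𝕜 W : Type*} [RCLike 𝕜] [MeasurableSpace Ω]
  [NormedAddCommGroup W] [NormedSpace 𝕜 W]

/-- The set function `n` (considered on measurable sets only) has bounded semivariation:
`sup { |f ∘ n|(Ω) : f ∈ W*, ‖f‖ ≤ 1 } < ∞`, where `|f ∘ n|(Ω)` is the supremum of
`∑ |f (n A)|` over the finite families of pairwise disjoint measurable sets. -/
def BoundedSemivariation (𝕜 : Type*) [RCLike 𝕜] [NormedSpace 𝕜 W] (n : Set Ω → W) : Prop :=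
  ∃ C : ℝ, ∀ f : StrongDual 𝕜 W, ‖f‖ ≤ 1 → ∀ P : Finset (Set Ω),
    (∀ A ∈ P, MeasurableSet A) → (P : Set (Set Ω)).PairwiseDisjoint id →
      ∑ A ∈ P, ‖f (n A)‖ ≤ C

/-- The integral `∫ s dn = ∑ a n(s = a)` of a scalar simple function. -/
def simpleIntegral (n : Set Ω → W) (s : SimpleFunc Ω 𝕜) : W :=
  ∑ a ∈ s.range, a • n (s ⁻¹' {a})

/-- `w` is the elementary Bartle integral `∫ φ dn`: the limit of the integrals of simple functions
that converge uniformly to `φ`. (For `n` additive and of bounded semivariation, the limit exists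
for every such sequence and does not depend on it.) -/
def HasBartleIntegral (n : Set Ω → W) (φ : Ω → 𝕜) (w : W) : Prop :=
  ∃ s : ℕ → SimpleFunc Ω 𝕜, TendstoUniformly (fun k ω => s k ω) φ atTop ∧
    Tendsto (fun k => simpleIntegral n (s k)) atTop (𝓝 w)

/-- Regularity of a scalar (real or complex) Borel measure `μ` on a compact Hausdorff space: every
Borel set `E` lies between a compact `K` and an open `V` such that `|μ|` is small on `V \ K`. -/
def IsRegular [TopologicalSpace Ω] (μ : VectorMeasure Ω 𝕜) : Prop :=
  ∀ E : Set Ω, MeasurableSet E → ∀ ε : ℝ, 0 < ε →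
    ∃ K V : Set Ω, IsCompact K ∧ IsOpen V ∧ K ⊆ E ∧ E ⊆ V ∧
      ∀ F : Set Ω, MeasurableSet F → F ⊆ V \ K → ‖μ F‖ < ε

/-- The weak `ℓ₁`-norm `‖(z_i)‖₁^w = sup { ∑ |f (z_i)| : f ∈ Z*, ‖f‖ ≤ 1 }`, in `[0, ∞]`. -/
def weakL1Norm (𝕜 : Type*) {Z : Type*} [RCLike 𝕜] [NormedAddCommGroup Z] [NormedSpace 𝕜 Z]
    (z : ℕ → Z) : ℝ≥0∞ :=
  ⨆ (f : StrongDual 𝕜 Z) (_ : ‖f‖ ≤ 1), ∑' i, ‖f (z i)‖ₑ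

end Measures

section Representing

variable {Ω 𝕜 X Y : Type*} [RCLike 𝕜] [TopologicalSpace Ω] [CompactSpace Ω] [MeasurableSpace Ω]
  [NormedAddCommGroup X] [NormedSpace 𝕜 X] [NormedAddCommGroup Y] [NormedSpace 𝕜 Y]

/-- `n : Σ → Y**` is the (classical) representing measure of `T ∈ L(C(Ω), Y)`: for every `y* ∈ Y*`
the set function `E ↦ ⟨y*, n(E)⟩` is a regular countably additive scalar Borel measure, `n` is of
bounded semivariation, and `T φ = ∫ φ dn` for all `φ ∈ C(Ω)`, where `Y ⊆ Y**` canonically.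
(Only the values of `n` on Borel sets matter; these are determined by `T`.) -/
structure IsScalarRepresentingMeasure (T : C(Ω, 𝕜) →L[𝕜] Y)
    (n : Set Ω → StrongDual 𝕜 (StrongDual 𝕜 Y)) : Prop where
  regular : ∀ y' : StrongDual 𝕜 Y, ∃ μ : VectorMeasure Ω 𝕜, IsRegular μ ∧
    ∀ E : Set Ω, MeasurableSet E → n E y' = μ E
  boundedSemivariation : BoundedSemivariation 𝕜 n
  integral : ∀ φ : C(Ω, 𝕜),
    HasBartleIntegral n (φ : Ω → 𝕜) (NormedSpace.inclusionInDoubleDual 𝕜 Y (T φ))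

/-- `m : Σ → L(X, Y**)` is the representing measure of `S ∈ L(C(Ω), L(X, Y))`: for every `x ∈ X`,
`E ↦ m(E) x` is the representing measure of the operator `S_x ∈ L(C(Ω), Y)`, `S_x φ = (S φ) x`. -/
def IsRepresentingMeasure (S : C(Ω, 𝕜) →L[𝕜] X →L[𝕜] Y)
    (m : Set Ω → X →L[𝕜] StrongDual 𝕜 (StrongDual 𝕜 Y)) : Prop :=
  ∀ x : X, IsScalarRepresentingMeasure (S.flip x) (fun E => m E x)

end Representing

end RepMeasure

end

/-! (a) ⇒ (b): fix finitely many disjoint `E i`, unit vectors `x i` and `y'` in the dual ball.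
Regularity of the scalar measures `⟨y', m(·) x i⟩` gives compact `K i ⊆ E i` and open `V i ⊇ E i`
with small gap. A partition of unity yields `φ i` equal to 1 on `K i`, vanishing off `V i`, with `∑
φ i ≤ 1`. Then `∑ φ i x i` lies in the unit ball of `C(Ω, X)`, and `y' (U (φ i x i))` nearly equals
`⟨y', m (E i) (x i)⟩`, so `‖∑ m (E i) (x i)‖ ≤ ‖U‖` (`norm_sum_apply_apply_le`). Rotating the `x i`
by unimodular scalars gives the weak ℓ₁ bound.

(b) ⇒ (a): `S` induces a linear map on `C(Ω) ⊗ X`. Its values are limits of integrals of `X`-valued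
simple functions, which (b) bounds by `c` times the sup norm (`norm_tensorLift_le`). The map
therefore extends to `C(Ω, X)` by density (`denseRange_tensorElem`). -/

namespace RepMeasure

/-! ### Scalar measures: estimates for integrals of simple functions -/

section ScalarIntegral

variable {Ω 𝕜 : Type*} [RCLike 𝕜] [MeasurableSpace Ω]

theorem sum_abs_le_two_mul {ι : Type*} (s : Finset ι) (r : ι → ℝ) {C : ℝ}
    (h : ∀ t ⊆ s, |∑ i ∈ t, r i| ≤ C) : ∑ i ∈ s, |r i| ≤ 2 * C := by
  classical
  rw [← Finset.sum_filter_add_sum_filter_not s (fun i => 0 ≤ r i)]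
  have h1 : ∑ i ∈ s with 0 ≤ r i, |r i| ≤ C := by
    refine le_trans (le_of_eq ?_) ((le_abs_self _).trans (h _ (Finset.filter_subset (fun i => 0 ≤ r i) s)))
    exact Finset.sum_congr rfl fun i hi => abs_of_nonneg (Finset.mem_filter.1 hi).2
  have h2 : ∑ i ∈ s with ¬ 0 ≤ r i, |r i| ≤ C := by
    refine le_trans (le_of_eq ?_) ((neg_le_abs _).trans (h _ (Finset.filter_subset (fun i => ¬ 0 ≤ r i) s)))
    rw [← Finset.sum_neg_distrib]
    exact Finset.sum_congr rfl fun i hi =>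
      abs_of_neg (not_le.1 (Finset.mem_filter.1 hi).2)
  linarith

/-- Real and imaginary parts are each split by sign, giving four subsums. This replaces total
variation: bounds on `‖μ F‖` control sums over disjoint sets. -/
theorem sum_norm_le_four_mul {ι : Type*} (s : Finset ι) (z : ι → 𝕜) {C : ℝ}
    (h : ∀ t ⊆ s, ‖∑ i ∈ t, z i‖ ≤ C) : ∑ i ∈ s, ‖z i‖ ≤ 4 * C := by
  have hre : ∑ i ∈ s, |RCLike.re (z i)| ≤ 2 * C := sum_abs_le_two_mul s _ fun t ht => by
    rw [← map_sum]
    exact (RCLike.abs_re_le_norm _).trans (h t ht)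
  have him : ∑ i ∈ s, |RCLike.im (z i)| ≤ 2 * C := sum_abs_le_two_mul s _ fun t ht => by
    rw [← map_sum]
    exact (RCLike.abs_im_le_norm _).trans (h t ht)
  calc ∑ i ∈ s, ‖z i‖ ≤ ∑ i ∈ s, (|RCLike.re (z i)| + |RCLike.im (z i)|) :=
        Finset.sum_le_sum fun i _ => by
          nth_rw 1 [← RCLike.re_add_im (z i)]
          refine norm_add_le_of_le (by rw [RCLike.norm_ofReal]) ?_
          rw [norm_mul, RCLike.norm_ofReal]
          refine mul_le_of_le_one_right (abs_nonneg _) ?_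
          by_cases hI : (RCLike.I : 𝕜) = 0
          · simp [hI]
          · exact (RCLike.norm_I_of_ne_zero hI).le
    _ ≤ 4 * C := by rw [Finset.sum_add_distrib]; linarith

/-- Multiplication by the measure of a set, as the integrand of `SimpleFunc.setToSimpleFunc`. -/
noncomputable def mulMeasure (μ : VectorMeasure Ω 𝕜) (A : Set Ω) : 𝕜 →L[ℝ] 𝕜 :=
  (ContinuousLinearMap.mul ℝ 𝕜).flip (μ A)

theorem mulMeasure_apply (μ : VectorMeasure Ω 𝕜) (A : Set Ω) (a : 𝕜) :
    mulMeasure μ A a = a * μ A := rfl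

/-- The zero reference measure makes every finiteness and integrability side condition trivial,
leaving pure finite additivity. -/
theorem finMeasAdditive_mulMeasure (μ : VectorMeasure Ω 𝕜) :
    FinMeasAdditive (0 : Measure Ω) (mulMeasure μ) := by
  intro A B hA hB _ _ hAB
  ext a
  simp only [mulMeasure_apply, _root_.add_apply, VectorMeasure.of_union hAB hA hB, mul_add]

theorem simpleIntegral_eq_setToSimpleFunc (μ : VectorMeasure Ω 𝕜) (s : SimpleFunc Ω 𝕜) :
    simpleIntegral μ s = s.setToSimpleFunc (mulMeasure μ) := rfl

theorem norm_setToSimpleFunc_mulMeasure_le (μ : VectorMeasure Ω 𝕜) {D : Set Ω} {C R : ℝ}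
    (hC : ∀ F, MeasurableSet F → F ⊆ D → ‖μ F‖ ≤ C) (g : SimpleFunc Ω 𝕜)
    (hR : 0 ≤ R) (hgD : ∀ ω, ω ∉ D → g ω = 0) (hgR : ∀ ω, ‖g ω‖ ≤ R) :
    ‖g.setToSimpleFunc (mulMeasure μ)‖ ≤ R * (4 * C) := by
  classical
  rw [SimpleFunc.setToSimpleFunc_eq_sum_filter]
  calc _ ≤ ∑ a ∈ g.range with a ≠ 0, R * ‖μ (g ⁻¹' {a})‖ := by
        refine norm_sum_le_of_le _ fun a ha => ?_
        obtain ⟨ω, rfl⟩ := SimpleFunc.mem_range.1 (Finset.mem_filter.1 ha).1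
        rw [mulMeasure_apply, norm_mul]
        gcongr
        exact hgR ω
    _ ≤ R * (4 * C) := by
        rw [← Finset.mul_sum]
        gcongr
        refine sum_norm_le_four_mul _ _ fun t ht => ?_
        rw [← VectorMeasure.of_biUnion_finset
          (fun a _ b _ hab => Disjoint.preimage _ (Set.disjoint_singleton.2 hab))
          (fun a _ => g.measurableSet_fiber a)]
        refine hC _ (t.measurableSet_biUnion fun a _ => g.measurableSet_fiber a) ?_
        intro ω hω
        simp only [Set.mem_iUnion, Set.mem_preimage, Set.mem_singleton_iff] at hω
        obtain ⟨a, ha, rfl⟩ := hω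
        by_contra h
        exact (Finset.mem_filter.1 (ht ha)).2 (hgD ω h)

theorem norm_sub_le_of_hasBartleIntegral (μ : VectorMeasure Ω 𝕜) {K E V : Set Ω} {C ε : ℝ}
    (hK : MeasurableSet K) (hE : MeasurableSet E) (hV : MeasurableSet V) (hKE : K ⊆ E)
    (hEV : E ⊆ V) (hC : ∀ F, MeasurableSet F → ‖μ F‖ ≤ C)
    (hε : ∀ F, MeasurableSet F → F ⊆ V \ K → ‖μ F‖ ≤ ε) {φ : Ω → 𝕜} {w : 𝕜}
    (hφ : ∀ ω, ‖φ ω‖ ≤ 1) (hφK : ∀ ω ∈ K, φ ω = 1) (hφV : ∀ ω, ω ∉ V → φ ω = 0)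
    (hw : HasBartleIntegral μ φ w) : ‖w - μ E‖ ≤ 5 * ε := by
  classical
  obtain ⟨s, hs, hsw⟩ := hw
  have hD : MeasurableSet (V \ K) := hV.diff hK
  -- Compare `s k` with the indicator of `K`. On `V \ K` the difference is at most `1 + δ` and `μ`
  -- is at most `ε`; elsewhere `φ` equals the indicator, so the difference is at most `δ`.
  have key : ∀ δ > 0, ‖w - μ K‖ ≤ (1 + δ) * (4 * ε) + δ * (4 * C) := by
    intro δ hδ
    refine le_of_tendsto (hsw.sub_const (μ K)).norm ?_
    filter_upwards [Metric.tendstoUniformly_iff.1 hs δ hδ] with k hk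
    set i : SimpleFunc Ω 𝕜 :=
      SimpleFunc.piecewise K hK (SimpleFunc.const Ω 1) (SimpleFunc.const Ω 0) with hi
    set g : SimpleFunc Ω 𝕜 := s k - i with hg
    have hiK : i.setToSimpleFunc (mulMeasure μ) = μ K := by
      rw [hi, SimpleFunc.setToSimpleFunc_indicator _
        (finMeasAdditive_mulMeasure μ).map_empty_eq_zero, mulMeasure_apply, one_mul]
    have hsplit : g = g.restrict (V \ K) + g.restrict (V \ K)ᶜ := by
      ext ω
      rw [SimpleFunc.add_apply, SimpleFunc.restrict_apply _ hD,
        SimpleFunc.restrict_apply _ hD.compl, ← Pi.add_apply, Set.indicator_self_add_compl]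
    have hk' : ∀ ω, ‖s k ω - φ ω‖ ≤ δ := fun ω => by
      rw [← dist_eq_norm, dist_comm]; exact (hk ω).le
    have hgi : ∀ ω, g ω = s k ω - K.indicator 1 ω := fun ω => by
      rw [hg, SimpleFunc.sub_apply, hi, SimpleFunc.coe_piecewise]
      by_cases hω : ω ∈ K <;> simp [hω]
    have e1 : simpleIntegral μ (s k) - μ K = g.setToSimpleFunc (mulMeasure μ) := by
      rw [hg, SimpleFunc.setToSimpleFunc_sub _ (finMeasAdditive_mulMeasure μ)
        integrable_zero_measure integrable_zero_measure, hiK, simpleIntegral_eq_setToSimpleFunc]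
    rw [e1, hsplit, SimpleFunc.setToSimpleFunc_add _ (finMeasAdditive_mulMeasure μ)
        integrable_zero_measure integrable_zero_measure]
    refine norm_add_le_of_le ?_ ?_
    · refine norm_setToSimpleFunc_mulMeasure_le μ hε _ (by positivity) (fun ω hω => ?_)
        fun ω => ?_
      · rw [SimpleFunc.restrict_apply _ hD, Set.indicator_of_notMem hω]
      · rw [SimpleFunc.restrict_apply _ hD]
        by_cases hω : ω ∈ V \ K
        · rw [Set.indicator_of_mem hω, hgi, Set.indicator_of_notMem hω.2, sub_zero]
          calc ‖s k ω‖ = ‖φ ω + (s k ω - φ ω)‖ := by rw [add_sub_cancel]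
            _ ≤ 1 + δ := norm_add_le_of_le (hφ ω) (hk' ω)
        · rw [Set.indicator_of_notMem hω, norm_zero]; positivity
    · refine norm_setToSimpleFunc_mulMeasure_le μ (D := Set.univ) (fun F hF _ => hC F hF) _ hδ.le
        (fun ω hω => absurd (Set.mem_univ ω) hω) fun ω => ?_
      rw [SimpleFunc.restrict_apply _ hD.compl]
      by_cases hω : ω ∈ V \ K
      · rw [Set.indicator_of_notMem (Set.notMem_compl_iff.2 hω), norm_zero]; exact hδ.le
      · rw [Set.indicator_of_mem hω, hgi]
        convert hk' ω using 3
        by_cases hωK : ω ∈ K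
        · simp [hωK, hφK ω hωK]
        · rw [Set.indicator_of_notMem hωK, hφV ω fun h => hω ⟨h, hωK⟩]
  have hwK : ‖w - μ K‖ ≤ 4 * ε := by
    have ht : Tendsto (fun δ : ℝ => (1 + δ) * (4 * ε) + δ * (4 * C)) (𝓝[>] 0)
        (𝓝 ((1 + 0) * (4 * ε) + 0 * (4 * C))) :=
      (Continuous.tendsto (by fun_prop) _).mono_left nhdsWithin_le_nhds
    have := ge_of_tendsto ht (eventually_mem_nhdsWithin.mono key)
    linarith
  have hEK : ‖μ K - μ E‖ ≤ ε := by
    rw [norm_sub_rev, ← VectorMeasure.of_sdiff hK hE hKE]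
    exact hε _ (hE.diff hK) (Set.sdiff_subset_sdiff_left hEV)
  calc ‖w - μ E‖ = ‖(w - μ K) + (μ K - μ E)‖ := by rw [sub_add_sub_cancel]
    _ ≤ 5 * ε := (norm_add_le_of_le hwK hEK).trans (by linarith)

end ScalarIntegral

end RepMeasure

namespace RepMeasure

/-! ### From the operator to the weak ℓ₁ bound -/

section OperatorToMeasure

variable {Ω 𝕜 X Y : Type*} [RCLike 𝕜] [TopologicalSpace Ω]
  [NormedAddCommGroup X] [NormedSpace 𝕜 X] [NormedAddCommGroup Y] [NormedSpace 𝕜 Y]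

theorem IsScalarRepresentingMeasure.exists_vectorMeasure [MeasurableSpace Ω] {T : C(Ω, 𝕜) →L[𝕜] Y}
    {n : Set Ω → StrongDual 𝕜 (StrongDual 𝕜 Y)} (hn : IsScalarRepresentingMeasure T n)
    {y' : StrongDual 𝕜 Y} (hy' : ‖y'‖ ≤ 1) :
    ∃ μ : VectorMeasure Ω 𝕜, IsRegular μ ∧ (∀ E, MeasurableSet E → n E y' = μ E) ∧
      (∃ C, ∀ F, MeasurableSet F → ‖μ F‖ ≤ C) ∧
      ∀ φ : C(Ω, 𝕜), HasBartleIntegral μ φ (y' (T φ)) := by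
  obtain ⟨μ, hμ, hnμ⟩ := hn.regular y'
  refine ⟨μ, hμ, hnμ, ?_, fun φ => ?_⟩
  · obtain ⟨C, hC⟩ := hn.boundedSemivariation
    refine ⟨C, fun F hF => ?_⟩
    have := hC (NormedSpace.inclusionInDoubleDual 𝕜 _ y')
      ((NormedSpace.double_dual_bound 𝕜 _ y').trans hy') {F} (by simpa using hF) (by simp)
    simpa [hnμ F hF] using this
  · obtain ⟨s, hs, hsT⟩ := hn.integral φ
    refine ⟨s, hs, ?_⟩
    -- Evaluation at `y'` is continuous on `Y**`, so it carries the vector integral to the scalar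
    -- one.
    have h := ((NormedSpace.inclusionInDoubleDual 𝕜 _ y').continuous.tendsto _).comp hsT
    rw [NormedSpace.dual_def, NormedSpace.dual_def] at h
    refine h.congr fun k => ?_
    simp only [Function.comp_apply, NormedSpace.dual_def, simpleIntegral, sum_apply,
      _root_.smul_apply]
    exact Finset.sum_congr rfl fun a _ => by rw [hnμ _ ((s k).measurableSet_fiber a)]

theorem IsRepresentingMeasure.apply_union [CompactSpace Ω] [MeasurableSpace Ω]
    {S : C(Ω, 𝕜) →L[𝕜] X →L[𝕜] Y} {m : Set Ω → X →L[𝕜] StrongDual 𝕜 (StrongDual 𝕜 Y)} (hm : IsRepresentingMeasure S m)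
    (A B : Set Ω) (hA : MeasurableSet A) (hB : MeasurableSet B) (hAB : Disjoint A B) (x : X) :
    m (A ∪ B) x = m A x + m B x := by
  ext y'
  obtain ⟨μ, -, hμ⟩ := (hm x).regular y'
  rw [_root_.add_apply, hμ _ (hA.union hB), hμ _ hA, hμ _ hB, VectorMeasure.of_union hAB hA hB]

/-- A real continuous function as a `𝕜`-valued one. -/
def ofRealMap (ρ : C(Ω, ℝ)) : C(Ω, 𝕜) where
  toFun ω := (ρ ω : 𝕜)
  continuous_toFun := by fun_prop

theorem ofRealMap_apply (ρ : C(Ω, ℝ)) (ω : Ω) : (ofRealMap ρ : C(Ω, 𝕜)) ω = (ρ ω : 𝕜) := rfl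

theorem elem_apply (φ : C(Ω, 𝕜)) (x : X) (ω : Ω) : elem φ x ω = φ ω • x := rfl

variable [CompactSpace Ω] [T2Space Ω] [MeasurableSpace Ω] [BorelSpace Ω]

theorem IsRepresentingMeasure.norm_sum_apply_apply_le {U : C(Ω, X) →L[𝕜] Y}
    {m : Set Ω → X →L[𝕜] StrongDual 𝕜 (StrongDual 𝕜 Y)}
    (hm : IsRepresentingMeasure (associated U) m) {ι : Type*} [Fintype ι] {E : ι → Set Ω}
    (hE : ∀ i, MeasurableSet (E i)) (hd : Pairwise fun i j => Disjoint (E i) (E j)) {x : ι → X}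
    (hx : ∀ i, ‖x i‖ ≤ 1) {y' : StrongDual 𝕜 Y} (hy' : ‖y'‖ ≤ 1) :
    ‖∑ i, m (E i) (x i) y'‖ ≤ ‖U‖ := by
  choose μ hreg hμ hC hint using fun i => (hm (x i)).exists_vectorMeasure hy'
  choose C hC using hC
  have key : ∀ ε > 0, ‖∑ i, m (E i) (x i) y'‖ ≤ ‖U‖ + Fintype.card ι * (5 * ε) := by
    intro ε hε
    choose K V hK hV hKE hEV hKV using fun i => hreg i (E i) (hE i) ε hε
    -- With the other compact sets removed, only `ρ i` is nonzero on `K i`, which forces `ρ i = 1`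
    -- there.
    have hO : ∀ i, IsOpen (V i \ ⋃ j ∈ {j | j ≠ i}, K j) := fun i =>
      (hV i).sdiff (Set.toFinite _ |>.isClosed_biUnion fun j _ => (hK j).isClosed)
    have hcover : ⋃ i, K i ⊆ ⋃ i, V i \ ⋃ j ∈ {j | j ≠ i}, K j := by
      refine Set.iUnion_mono fun i ω hω => ⟨hEV i (hKE i hω), fun h => ?_⟩
      simp only [Set.mem_iUnion] at h
      obtain ⟨j, hj, hωj⟩ := h
      exact (hd hj).notMem_of_mem_left (hKE j hωj) (hKE i hω)
    obtain ⟨ρ, hρ⟩ := PartitionOfUnity.exists_isSubordinate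
      (isClosed_iUnion_of_finite fun i => (hK i).isClosed) _ hO hcover
    have hρ0 : ∀ i ω, ω ∉ V i \ ⋃ j ∈ {j | j ≠ i}, K j → ρ i ω = 0 := fun i ω hω =>
      image_eq_zero_of_notMem_tsupport fun h => hω (hρ i h)
    have hρ1 : ∀ i, ∀ ω ∈ K i, ρ i ω = 1 := fun i ω hω => by
      rw [← ρ.sum_eq_one (Set.mem_iUnion_of_mem i hω), finsum_eq_single _ i]
      intro j hj
      exact hρ0 j ω fun h => h.2 (Set.mem_biUnion (Ne.symm hj) hω)
    set φ : ι → C(Ω, 𝕜) := fun i => ofRealMap (ρ i) with hφ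
    have hφn : ∀ i ω, ‖φ i ω‖ = ρ i ω := fun i ω => by
      rw [hφ, ofRealMap_apply, RCLike.norm_ofReal, abs_of_nonneg (ρ.nonneg i ω)]
    have hψ : ‖∑ i, elem (φ i) (x i)‖ ≤ 1 := by
      rw [ContinuousMap.norm_le _ zero_le_one]
      intro ω
      rw [ContinuousMap.sum_apply]
      calc _ ≤ ∑ i, ρ i ω := norm_sum_le_of_le _ fun i _ => by
            rw [elem_apply, norm_smul, hφn]
            exact mul_le_of_le_one_right (ρ.nonneg i ω) (hx i)
        _ ≤ 1 := by rw [← finsum_eq_sum_of_fintype]; exact ρ.sum_le_one ω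
    have happrox : ∀ i, ‖y' (U (elem (φ i) (x i))) - m (E i) (x i) y'‖ ≤ 5 * ε := fun i => by
      rw [hμ i _ (hE i)]
      refine norm_sub_le_of_hasBartleIntegral (μ i) (hK i).measurableSet (hE i)
        (hV i).measurableSet (hKE i) (hEV i) (hC i) (fun F hF hFD => (hKV i F hF hFD).le)
        (φ := φ i) (fun ω => (hφn i ω).trans_le (ρ.le_one i ω)) (fun ω hω => ?_) (fun ω hω => ?_)
        (hint i (φ i))
      · rw [hφ, ofRealMap_apply, hρ1 i ω hω, RCLike.ofReal_one]
      · rw [hφ, ofRealMap_apply, hρ0 i ω fun h => hω h.1, RCLike.ofReal_zero]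
    calc ‖∑ i, m (E i) (x i) y'‖
        = ‖y' (U (∑ i, elem (φ i) (x i))) -
            ∑ i, (y' (U (elem (φ i) (x i))) - m (E i) (x i) y')‖ := by
          rw [Finset.sum_sub_distrib, map_sum, map_sum, sub_sub_cancel]
      _ ≤ ‖U‖ + Fintype.card ι * (5 * ε) := by
          refine norm_sub_le_of_le ?_ ?_
          · calc _ ≤ ‖y'‖ * ‖U (∑ i, elem (φ i) (x i))‖ := y'.le_opNorm _
              _ ≤ 1 * (‖U‖ * 1) := by
                gcongr
                exact U.le_of_opNorm_le_of_le le_rfl hψ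
              _ = ‖U‖ := by ring
          · refine (norm_sum_le_of_le _ fun i _ => happrox i).trans_eq ?_
            rw [Finset.sum_const, Finset.card_univ, nsmul_eq_mul]
  have ht : Tendsto (fun ε : ℝ => ‖U‖ + Fintype.card ι * (5 * ε)) (𝓝[>] 0)
      (𝓝 (‖U‖ + Fintype.card ι * (5 * 0))) :=
    (Continuous.tendsto (by fun_prop) _).mono_left nhdsWithin_le_nhds
  simpa using ge_of_tendsto ht (eventually_mem_nhdsWithin.mono key)

theorem IsRepresentingMeasure.weakL1Norm_le {U : C(Ω, X) →L[𝕜] Y}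
    {m : Set Ω → X →L[𝕜] StrongDual 𝕜 (StrongDual 𝕜 Y)}
    (hm : IsRepresentingMeasure (associated U) m) {E : ℕ → Set Ω}
    (hE : ∀ i, MeasurableSet (E i)) (hd : Pairwise fun i j => Disjoint (E i) (E j)) {x : ℕ → X}
    (hx : ∀ i, ‖x i‖ ≤ 1) :
    weakL1Norm 𝕜 (fun i => m (E i) (x i)) ≤ ENNReal.ofReal ‖U‖ := by
  refine iSup₂_le fun f hf => ENNReal.tsum_le_of_sum_range_le fun N => ?_
  -- The unimodular `a i` are absorbed into the `x i`, turning the sum of absolute values into `f`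
  -- of a single vector of norm at most `‖U‖`.
  choose a ha1 ha using fun i => RCLike.exists_norm_eq_mul_self (f (m (E i) (x i)))
  have hnorm : ‖∑ i : Fin N, m (E i) (a i • x i)‖ ≤ ‖U‖ := by
    refine ContinuousLinearMap.opNorm_le_of_unit_norm (norm_nonneg _) fun y' hy' => ?_
    rw [sum_apply]
    exact hm.norm_sum_apply_apply_le (fun i : Fin N => hE i)
      (fun i j hij => hd (Fin.val_injective.ne hij))
      (fun i => by rw [norm_smul, ha1, one_mul]; exact hx i) hy'.le
  rw [← Fin.sum_univ_eq_sum_range (fun i => ‖f (m (E i) (x i))‖ₑ)]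
  simp_rw [← ofReal_norm]
  rw [← ENNReal.ofReal_sum_of_nonneg fun _ _ => norm_nonneg _]
  refine ENNReal.ofReal_le_ofReal ?_
  have hsum : ((∑ i : Fin N, ‖f (m (E i) (x i))‖ : ℝ) : 𝕜) =
      f (∑ i : Fin N, m (E i) (a i • x i)) := by
    rw [RCLike.ofReal_sum, map_sum]
    exact Finset.sum_congr rfl fun i _ => by rw [ha, map_smul, map_smul, smul_eq_mul]
  calc _ ≤ ‖((∑ i : Fin N, ‖f (m (E i) (x i))‖ : ℝ) : 𝕜)‖ := by
        rw [RCLike.norm_ofReal]; exact le_abs_self _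
    _ ≤ 1 * ‖U‖ := by rw [hsum]; exact f.le_of_opNorm_le_of_le hf hnorm
    _ = ‖U‖ := one_mul _

end OperatorToMeasure

end RepMeasure

open scoped TensorProduct

namespace RepMeasure

/-! ### The algebraic tensor product inside `C(Ω, X)` -/

section Tensor

variable {Ω 𝕜 X : Type*} [RCLike 𝕜] [TopologicalSpace Ω] [NormedAddCommGroup X] [NormedSpace 𝕜 X]

variable (Ω 𝕜 X) in
/-- The canonical map `C(Ω) ⊗ X → C(Ω, X)`, `φ ⊗ x ↦ φ x`. -/
def tensorElem : C(Ω, 𝕜) ⊗[𝕜] X →ₗ[𝕜] C(Ω, X) :=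
  TensorProduct.lift (LinearMap.mk₂ 𝕜 elem
    (fun φ ψ x => by ext ω; exact add_smul (φ ω) (ψ ω) x)
    (fun a φ x => by ext ω; exact smul_assoc a (φ ω) x)
    (fun φ x y => by ext ω; exact smul_add (φ ω) x y)
    (fun a φ x => by ext ω; exact smul_comm (φ ω) a x))

theorem tensorElem_tmul (φ : C(Ω, 𝕜)) (x : X) : tensorElem Ω 𝕜 X (φ ⊗ₜ x) = elem φ x := by
  simp [tensorElem]

/-- A partition of unity subordinate to finitely many sets on which `f` is within `ε / 2` of `f i`
makes `∑ ρ i • f i` a uniform approximation. -/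
theorem denseRange_tensorElem [CompactSpace Ω] [T2Space Ω] : DenseRange (tensorElem Ω 𝕜 X) := by
  intro f
  refine Metric.mem_closure_range_iff.2 fun ε hε => ?_
  obtain ⟨t, ht⟩ := isCompact_univ.elim_finite_subcover
    (fun ω₀ : Ω => f ⁻¹' Metric.ball (f ω₀) (ε / 2))
    (fun ω₀ => Metric.isOpen_ball.preimage f.continuous)
    fun ω _ => Set.mem_iUnion_of_mem ω (Metric.mem_ball_self (half_pos hε))
  obtain ⟨ρ, hρ⟩ := PartitionOfUnity.exists_isSubordinate isClosed_univ
    (fun ω₀ : t => f ⁻¹' Metric.ball (f ω₀) (ε / 2))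
    (fun ω₀ => Metric.isOpen_ball.preimage f.continuous)
    (ht.trans (Set.iUnion₂_subset fun ω₀ h =>
      Set.subset_iUnion (fun ω₀ : t => f ⁻¹' Metric.ball (f ω₀) (ε / 2)) ⟨ω₀, h⟩))
  refine ⟨∑ i, ofRealMap (ρ i) ⊗ₜ f i, ?_⟩
  refine lt_of_le_of_lt ?_ (half_lt_self hε)
  rw [dist_eq_norm, ContinuousMap.norm_le _ (half_pos hε).le]
  intro ω
  have hsum : ∑ i, ρ i ω = 1 := by
    rw [← finsum_eq_sum_of_fintype]; exact ρ.sum_eq_one (Set.mem_univ ω)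
  have hf : f ω = ∑ i, (ρ i ω : 𝕜) • f ω := by
    rw [← Finset.sum_smul, ← RCLike.ofReal_sum, hsum, RCLike.ofReal_one, one_smul]
  rw [ContinuousMap.sub_apply, map_sum, ContinuousMap.sum_apply]
  simp only [tensorElem_tmul, elem_apply, ofRealMap_apply]
  nth_rw 1 [hf]
  rw [← Finset.sum_sub_distrib]
  calc _ ≤ ∑ i, ρ i ω * (ε / 2) := norm_sum_le_of_le _ fun i _ => by
        rw [← smul_sub, norm_smul, RCLike.norm_ofReal, abs_of_nonneg (ρ.nonneg i ω)]
        by_cases h : ω ∈ tsupport (ρ i)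
        · gcongr
          · exact ρ.nonneg i ω
          · rw [← dist_eq_norm]; exact (hρ i h).le
        · rw [image_eq_zero_of_notMem_tsupport h, zero_mul, zero_mul]
    _ = ε / 2 := by rw [← Finset.sum_mul, hsum, one_mul]

variable {Y : Type*} [NormedAddCommGroup Y] [NormedSpace 𝕜 Y] {S : C(Ω, 𝕜) →L[𝕜] X →L[𝕜] Y}

variable (S) in
/-- The linear map `C(Ω) ⊗ X → Y` induced by `S`. -/
def tensorLift : C(Ω, 𝕜) ⊗[𝕜] X →ₗ[𝕜] Y :=
  TensorProduct.lift (ContinuousLinearMap.coeLM 𝕜 ∘ₗ S.toLinearMap)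

theorem tensorLift_tmul (φ : C(Ω, 𝕜)) (x : X) : tensorLift S (φ ⊗ₜ x) = S φ x := by
  simp [tensorLift]

end Tensor

/-! ### From the weak ℓ₁ bound to the operator -/

section MeasureToOperator

variable {Ω 𝕜 X Y : Type*} [RCLike 𝕜] [MeasurableSpace Ω]
  [NormedAddCommGroup X] [NormedSpace 𝕜 X]

theorem sum_norm_apply_le_of_weakL1Norm_le {Z : Type*} [NormedAddCommGroup Z] [NormedSpace 𝕜 Z]
    {m : Set Ω → X →L[𝕜] Z} {c : ℝ} (hc : 0 ≤ c)
    (hb : ∀ E : ℕ → Set Ω, (∀ i, MeasurableSet (E i)) →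
      Pairwise (fun i j => Disjoint (E i) (E j)) → ∀ x : ℕ → X, (∀ i, ‖x i‖ ≤ 1) →
        weakL1Norm 𝕜 (fun i => m (E i) (x i)) ≤ ENNReal.ofReal c)
    {ι : Type*} [Fintype ι] {A : ι → Set Ω} (hA : ∀ i, MeasurableSet (A i))
    (hd : Pairwise fun i j => Disjoint (A i) (A j)) {v : ι → X} (hv : ∀ i, ‖v i‖ ≤ 1)
    {f : StrongDual 𝕜 Z} (hf : ‖f‖ ≤ 1) : ∑ i, ‖f (m (A i) (v i))‖ ≤ c := by
  obtain ⟨j, hj⟩ : ∃ j : ι → ℕ, Function.Injective j :=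
    ⟨_, Fin.val_injective.comp (Fintype.equivFin ι).injective⟩
  -- Padding the finite family with `∅` and `0` preserves disjointness and the unit ball condition.
  set E : ℕ → Set Ω := Function.extend j A fun _ => ∅ with hE
  set x : ℕ → X := Function.extend j v fun _ => 0 with hx
  have hEj : ∀ i, E (j i) = A i := fun i => hj.extend_apply _ _ i
  have hxj : ∀ i, x (j i) = v i := fun i => hj.extend_apply _ _ i
  have hE0 : ∀ n, (¬ ∃ i, j i = n) → E n = ∅ := fun n hn => Function.extend_apply' _ _ n hn
  have hx0 : ∀ n, (¬ ∃ i, j i = n) → x n = 0 := fun n hn => Function.extend_apply' _ _ n hn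
  have h := hb E (fun n => ?_) (fun n k hnk => ?_) x (fun n => ?_)
  · have h' : ∑ i, ‖f (m (A i) (v i))‖ₑ ≤ ENNReal.ofReal c := by
      calc _ = ∑' i, ‖f (m (E (j i)) (x (j i)))‖ₑ := by simp_rw [tsum_fintype, hEj, hxj]
        _ ≤ ∑' n, ‖f (m (E n) (x n))‖ₑ :=
          ENNReal.tsum_comp_le_tsum_of_injective hj fun n => ‖f (m (E n) (x n))‖ₑ
        _ ≤ _ := (le_iSup₂ (f := fun (f : StrongDual 𝕜 Z) (_ : ‖f‖ ≤ 1) =>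
            ∑' n, ‖f (m (E n) (x n))‖ₑ) f hf).trans h
    simp_rw [← ofReal_norm] at h'
    rwa [← ENNReal.ofReal_sum_of_nonneg fun _ _ => norm_nonneg _,
      ENNReal.ofReal_le_ofReal_iff hc] at h'
  · by_cases hn : ∃ i, j i = n
    · obtain ⟨i, rfl⟩ := hn
      rw [hEj]; exact hA i
    · rw [hE0 n hn]; exact MeasurableSet.empty
  · by_cases hn : ∃ i, j i = n
    · by_cases hk : ∃ i, j i = k
      · obtain ⟨a, rfl⟩ := hn
        obtain ⟨b, rfl⟩ := hk
        rw [hEj, hEj]; exact hd fun hab => hnk (congrArg j hab)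
      · simp only [hE0 k hk]; exact Set.disjoint_empty _
    · simp only [hE0 n hn]; exact Set.empty_disjoint _
  · by_cases hn : ∃ i, j i = n
    · obtain ⟨i, rfl⟩ := hn
      rw [hxj]; exact hv i
    · rw [hx0 n hn, norm_zero]; exact zero_le_one

variable [NormedSpace ℝ X] [IsScalarTower ℝ 𝕜 X]
  {Z : Type*} [NormedAddCommGroup Z] [NormedSpace 𝕜 Z] [NormedSpace ℝ Z] [IsScalarTower ℝ 𝕜 Z]

/-- The set function `m` with its values regarded as real linear operators. -/
noncomputable def realOperator (m : Set Ω → X →L[𝕜] Z) (A : Set Ω) : X →L[ℝ] Z :=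
  (m A).restrictScalars ℝ

/-- The fibres of `g` are disjoint and its values divided by `R` lie in the unit ball, so the weak
ℓ₁ bound applies to a functional norming the integral. -/
theorem norm_setToSimpleFunc_le_of_weakL1Norm_le {m : Set Ω → X →L[𝕜] Z} {c : ℝ} (hc : 0 ≤ c)
    (hb : ∀ E : ℕ → Set Ω, (∀ i, MeasurableSet (E i)) →
      Pairwise (fun i j => Disjoint (E i) (E j)) → ∀ x : ℕ → X, (∀ i, ‖x i‖ ≤ 1) →
        weakL1Norm 𝕜 (fun i => m (E i) (x i)) ≤ ENNReal.ofReal c)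
    (g : SimpleFunc Ω X) {R : ℝ} (hR : 0 < R) (hg : ∀ ω, ‖g ω‖ ≤ R) :
    ‖g.setToSimpleFunc (realOperator m)‖ ≤ c * R := by
  obtain ⟨f, hf, hfz⟩ := exists_dual_vector'' 𝕜
    (g.setToSimpleFunc (realOperator m))
  have hRn : ‖(R : 𝕜)‖ = R := by rw [RCLike.norm_ofReal, abs_of_pos hR]
  have hR0 : (R : 𝕜) ≠ 0 := by exact_mod_cast hR.ne'
  have h := sum_norm_apply_le_of_weakL1Norm_le hc hb (ι := g.range)
    (A := fun a => g ⁻¹' {a.1}) (fun a => g.measurableSet_fiber a)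
    (fun a b hab => Disjoint.preimage _
      (Set.disjoint_singleton.2 (Subtype.val_injective.ne hab)))
    (v := fun a => (R : 𝕜)⁻¹ • a.1) (fun a => ?_) hf
  · rw [Finset.sum_coe_sort g.range fun a => ‖f (m (g ⁻¹' {a}) ((R : 𝕜)⁻¹ • a))‖] at h
    calc _ = ‖f (g.setToSimpleFunc (realOperator m))‖ := by
          rw [hfz, RCLike.norm_ofReal, abs_norm]
      _ ≤ ∑ a ∈ g.range, ‖f (m (g ⁻¹' {a}) a)‖ := by
          rw [SimpleFunc.setToSimpleFunc, map_sum]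
          exact norm_sum_le _ _
      _ = (∑ a ∈ g.range, ‖f (m (g ⁻¹' {a}) ((R : 𝕜)⁻¹ • a))‖) * R := by
          rw [Finset.sum_mul]
          refine Finset.sum_congr rfl fun a _ => ?_
          rw [map_smul, map_smul, norm_smul, norm_inv, hRn]
          field_simp
      _ ≤ c * R := by gcongr
  · obtain ⟨ω, hω⟩ := SimpleFunc.mem_range.1 a.2
    rw [norm_smul, norm_inv, hRn, ← hω, inv_mul_le_iff₀ hR, mul_one]
    exact hg ω

theorem finMeasAdditive_realOperator {m : Set Ω → X →L[𝕜] Z}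
    (hadd : ∀ A B, MeasurableSet A → MeasurableSet B → Disjoint A B →
      ∀ x, m (A ∪ B) x = m A x + m B x) :
    FinMeasAdditive (0 : Measure Ω) (realOperator m) := by
  intro A B hA hB _ _ hAB
  ext x
  exact hadd A B hA hB hAB x

variable [NormedAddCommGroup Y] [NormedSpace 𝕜 Y] {m : Set Ω → X →L[𝕜] Z} [TopologicalSpace Ω]
  {S : C(Ω, 𝕜) →L[𝕜] X →L[𝕜] Y} {J : Y →ₗᵢ[𝕜] Z}

/-- One sequence serves both limits, so a bound by the sup norm of `g k` passes to `tensorLift S t`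
in terms of the function alone. On pure tensors, scalar simple functions are multiplied by `x`. -/
theorem exists_simpleFunc_tendsto
    (hadd : ∀ A B, MeasurableSet A → MeasurableSet B → Disjoint A B →
      ∀ x, m (A ∪ B) x = m A x + m B x)
    (hint : ∀ (x : X) (φ : C(Ω, 𝕜)), HasBartleIntegral (fun A => m A x) φ (J (S φ x))) (t : C(Ω, 𝕜) ⊗[𝕜] X) :
    ∃ g : ℕ → SimpleFunc Ω X,
      TendstoUniformly (fun k ω => g k ω) (tensorElem Ω 𝕜 X t) atTop ∧
      Tendsto (fun k => (g k).setToSimpleFunc (realOperator m)) atTop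
        (𝓝 (J (tensorLift S t))) := by
  induction t using TensorProduct.induction_on with
  | zero =>
    refine ⟨fun _ => 0, ?_, ?_⟩
    · rw [map_zero]
      exact Metric.tendstoUniformly_iff.2 fun ε hε => .of_forall fun _ _ => by simpa using hε
    · simp only [map_zero, SimpleFunc.setToSimpleFunc_zero_apply]
      exact tendsto_const_nhds
  | tmul φ x =>
    obtain ⟨s, hs, hsT⟩ := hint x φ
    refine ⟨fun k => (s k).map fun a => a • x, ?_, ?_⟩
    · rw [tensorElem_tmul]
      exact ((ContinuousLinearMap.id 𝕜 𝕜).smulRight x).uniformContinuous.comp_tendstoUniformly hs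
    · rw [tensorLift_tmul]
      refine hsT.congr fun k => ?_
      rw [SimpleFunc.map_setToSimpleFunc _ (finMeasAdditive_realOperator hadd) integrable_zero_measure
        (zero_smul 𝕜 x)]
      exact Finset.sum_congr rfl fun a _ => (map_smul (m _) a x).symm
  | add t u ht hu =>
    obtain ⟨g, hg, hgT⟩ := ht
    obtain ⟨h, hh, hhT⟩ := hu
    refine ⟨fun k => g k + h k, ?_, ?_⟩
    · rw [map_add]
      exact hg.add hh
    · rw [map_add, map_add]
      refine (hgT.add hhT).congr fun k => ?_
      rw [SimpleFunc.setToSimpleFunc_add _ (finMeasAdditive_realOperator hadd) integrable_zero_measure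
        integrable_zero_measure]

theorem norm_tensorLift_le [CompactSpace Ω]
    (hadd : ∀ A B, MeasurableSet A → MeasurableSet B → Disjoint A B →
      ∀ x, m (A ∪ B) x = m A x + m B x)
    (hint : ∀ (x : X) (φ : C(Ω, 𝕜)), HasBartleIntegral (fun A => m A x) φ (J (S φ x))) {c : ℝ} (hc : 0 ≤ c)
    (hb : ∀ E : ℕ → Set Ω, (∀ i, MeasurableSet (E i)) →
      Pairwise (fun i j => Disjoint (E i) (E j)) → ∀ x : ℕ → X, (∀ i, ‖x i‖ ≤ 1) →
        weakL1Norm 𝕜 (fun i => m (E i) (x i)) ≤ ENNReal.ofReal c)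
    (t : C(Ω, 𝕜) ⊗[𝕜] X) : ‖tensorLift S t‖ ≤ c * ‖tensorElem Ω 𝕜 X t‖ := by
  obtain ⟨g, hg, hgT⟩ := exists_simpleFunc_tendsto hadd hint t
  have key : ∀ δ > 0, ‖tensorLift S t‖ ≤ c * (‖tensorElem Ω 𝕜 X t‖ + δ) := by
    intro δ hδ
    rw [← J.norm_map (tensorLift S t)]
    refine le_of_tendsto hgT.norm ?_
    filter_upwards [Metric.tendstoUniformly_iff.1 hg δ hδ] with k hk
    -- The radius is `‖tensorElem Ω 𝕜 X t‖ + δ`, positive even when the function is zero.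
    refine norm_setToSimpleFunc_le_of_weakL1Norm_le hc hb _ (by positivity) fun ω => ?_
    have h1 : ‖g k ω - tensorElem Ω 𝕜 X t ω‖ ≤ δ := by
      rw [← dist_eq_norm, dist_comm]; exact (hk ω).le
    calc ‖g k ω‖ = ‖tensorElem Ω 𝕜 X t ω + (g k ω - tensorElem Ω 𝕜 X t ω)‖ := by
          rw [add_sub_cancel]
      _ ≤ _ := norm_add_le_of_le ((tensorElem Ω 𝕜 X t).norm_coe_le_norm ω) h1
  have ht : Tendsto (fun δ : ℝ => c * (‖tensorElem Ω 𝕜 X t‖ + δ)) (𝓝[>] 0)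
      (𝓝 (c * (‖tensorElem Ω 𝕜 X t‖ + 0))) :=
    (Continuous.tendsto (by fun_prop) _).mono_left nhdsWithin_le_nhds
  simpa using ge_of_tendsto ht (eventually_mem_nhdsWithin.mono key)

end MeasureToOperator

end RepMeasure

/-! ### The equivalence -/

theorem proposition4p4 {𝕜 Ω X Y : Type*} [RCLike 𝕜]
    [TopologicalSpace Ω] [CompactSpace Ω] [T2Space Ω] [MeasurableSpace Ω] [BorelSpace Ω]
    [NormedAddCommGroup X] [NormedSpace 𝕜 X] [CompleteSpace X]
    [NormedAddCommGroup Y] [NormedSpace 𝕜 Y] [CompleteSpace Y]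
    (S : C(Ω, 𝕜) →L[𝕜] X →L[𝕜] Y)
    (m : Set Ω → X →L[𝕜] StrongDual 𝕜 (StrongDual 𝕜 Y))
    (hm : RepMeasure.IsRepresentingMeasure S m) :
    (∃ U : C(Ω, X) →L[𝕜] Y, RepMeasure.associated U = S) ↔
      ∃ c : ℝ, 0 < c ∧ ∀ E : ℕ → Set Ω, (∀ i, MeasurableSet (E i)) →
        Pairwise (fun i j => Disjoint (E i) (E j)) →
        ∀ x : ℕ → X, (∀ i, x i ∈ Metric.closedBall (0 : X) 1) →
          RepMeasure.weakL1Norm 𝕜 (fun i => m (E i) (x i)) ≤ ENNReal.ofReal c := by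
  simp only [mem_closedBall_zero_iff]
  constructor
  · rintro ⟨U, rfl⟩
    exact ⟨‖U‖ + 1, by positivity, fun E hE hd x hx =>
      (hm.weakL1Norm_le hE hd hx).trans (ENNReal.ofReal_le_ofReal (by linarith))⟩
  · rintro ⟨c, hc, hb⟩
    let _ : NormedSpace ℝ X := NormedSpace.restrictScalars ℝ 𝕜 X
    have : IsScalarTower ℝ 𝕜 X := IsScalarTower.of_algebraMap_smul fun _ _ => rfl
    have hbound : ∀ t, ‖RepMeasure.tensorLift S t‖ ≤ c * ‖RepMeasure.tensorElem Ω 𝕜 X t‖ := by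
      refine RepMeasure.norm_tensorLift_le (Z := StrongDual 𝕜 (StrongDual 𝕜 Y)) (m := m)
        (J := NormedSpace.inclusionInDoubleDualLi (E := Y) 𝕜) ?_ ?_ hc.le ?_
      · exact hm.apply_union
      · intro x φ
        exact (hm x).integral φ
      · exact hb
    -- By `hbound`, `tensorLift S` vanishes on the kernel of `tensorElem`, so injectivity of the
    -- latter is not needed.
    refine ⟨(RepMeasure.tensorLift S).extendOfNorm (RepMeasure.tensorElem Ω 𝕜 X), ?_⟩
    ext φ x
    rw [RepMeasure.associated_apply, ← RepMeasure.tensorElem_tmul,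
      LinearMap.extendOfNorm_eq RepMeasure.denseRange_tensorElem ⟨c, hbound⟩,
      RepMeasure.tensorLift_tmul]
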